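/- Let $n\ge 1$. Let $B_n^+$ be the monoid of positive $n$-strand braids, presented by generators $\sigma_1,\dots,\sigma_{n-1}$ and the relations $\sigma_i\sigma_j=\sigma_j\sigma_i$ for $|i-j|\ge 2$ and $\sigma_i\sigma_j\sigma_i=\sigma_j\sigma_i\sigma_j$ for $|i-j|=1$. Define $\Delta_1=1$ and $\Delta_m=\sigma_1\sigma_2\cdots\sigma_{m-1}\Delta_{m-1}$ for $m \geq 2$. Call an element of $B_n^+$ simple if it is a left divisor of $\Delta_n$ in $B_n^+$; there are finitely many simple elements. For $x$ in $B_n^+$, let $D_L(x)$ (resp. $D_R(x)$) be the set of all $i\in\{1,\dots,n-1\}$ such that $\sigma_i$ is a left (resp. right) divisor of $x$ in $B_n^+$. For $I,J\subseteq\{1,\dots,n-1\}$, let $a_{n,I,J}$ (resp. $\widehat a_{n,I,J}$) be the number of simple $x \in B_n^+$ with $D_L(x)=I$ (resp. $D_L(x)\supseteq I$) and $D_R(x)\supseteq J$. Finally, let $\{I\}_n$ be the partition of $n$ obtained by arranging in non-increasing order the numbers $p_1,\,p_2-p_1,\,\dots,\,p_k-p_{k-1}$, where $p_1<\dots<p_k$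 are the elements of $\{1,\dots,n\}\setminus I$. (i) The number $\widehat a_{n,I,J}$ depends only on the partitions $\{I\}_n$ and $\{J\}_n$: for all $I,I',J,J'\subseteq\{1,\dots,n-1\}$ with $\{I\}_n=\{I'\}_n$ and $\{J\}_n=\{J'\}_n$, one has $\widehat a_{n,I,J}=\widehat a_{n,I',J'}$. (ii) For fixed $n$ and $I$, the number $a_{n,I,J}$ depends only on the partition $\{J\}_n$: for all $I,J,J'\subseteq\{1,\dots,n-1\}$ with $\{J\}_n=\{J'\}_n$, one has $a_{n,I,J}=a_{n,I,J'}$. -/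

import Mathlib

/-- The index set `{1, …, n-1}` of the standard generators of the `n`-strand braid monoid. -/
abbrev BraidGen (n : ℕ) : Type := {i : ℕ // 1 ≤ i ∧ i < n}

/-- The braid relations: `σᵢ σⱼ = σⱼ σᵢ` for `|i - j| ≥ 2`, and `σᵢ σⱼ σᵢ = σⱼ σᵢ σⱼ` for
`|i - j| = 1`. Both are symmetric in `i, j` up to exchanging the two sides, so that it suffices
to list them for `i < j`. -/
inductive BraidRel (n : ℕ) : FreeMonoid (BraidGen n) → FreeMonoid (BraidGen n) → Prop
  | comm (i j : BraidGen n) (h : i.1 + 2 ≤ j.1) :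
      BraidRel n (FreeMonoid.of i * FreeMonoid.of j) (FreeMonoid.of j * FreeMonoid.of i)
  | braid (i j : BraidGen n) (h : i.1 + 1 = j.1) :
      BraidRel n (FreeMonoid.of i * FreeMonoid.of j * FreeMonoid.of i)
        (FreeMonoid.of j * FreeMonoid.of i * FreeMonoid.of j)

/-- The monoid `B_n^+` of positive `n`-strand braids. -/
abbrev BraidMonoid (n : ℕ) : Type := PresentedMonoid (BraidRel n)

namespace BraidMonoid

/-- The generator `σᵢ` of `B_n^+`. -/
def sigma {n : ℕ} (i : BraidGen n) : BraidMonoid n := PresentedMonoid.of (BraidRel n) i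

/-- The homomorphism `B_n^+ → B_{n+1}^+` that sends `σᵢ` to `σᵢ`. -/
def incl (n : ℕ) : BraidMonoid n →* BraidMonoid (n + 1) :=
  PresentedMonoid.lift (fun i : BraidGen n => sigma ⟨i.1, i.2.1, Nat.lt_succ_of_lt i.2.2⟩) (by
    intro a b h
    cases h with
    | comm i j h =>
      simpa [sigma, PresentedMonoid.of] using PresentedMonoid.mk_eq_mk_of_rel (BraidRel.comm
        (n := n + 1) ⟨i.1, i.2.1, Nat.lt_succ_of_lt i.2.2⟩
        ⟨j.1, j.2.1, Nat.lt_succ_of_lt j.2.2⟩ h)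
    | braid i j h =>
      simpa [sigma, PresentedMonoid.of] using PresentedMonoid.mk_eq_mk_of_rel (BraidRel.braid
        (n := n + 1) ⟨i.1, i.2.1, Nat.lt_succ_of_lt i.2.2⟩
        ⟨j.1, j.2.1, Nat.lt_succ_of_lt j.2.2⟩ h))

/-- The braid `Δ_n`: `Δ_1 = 1` and `Δ_{n+1} = σ_1 σ_2 ⋯ σ_n Δ_n`. -/
def Delta : (n : ℕ) → BraidMonoid n
  | 0 => 1
  | n + 1 => (List.ofFn fun k : Fin n =>
      sigma (n := n + 1) ⟨k.1 + 1, Nat.succ_pos _, Nat.succ_lt_succ k.2⟩).prod * incl n (Delta n)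

/-- `x` is a left divisor of `y` in `B_n^+`. -/
def LeftDivides {n : ℕ} (x y : BraidMonoid n) : Prop := ∃ z : BraidMonoid n, y = x * z

/-- `x` is a right divisor of `y` in `B_n^+`. -/
def RightDivides {n : ℕ} (x y : BraidMonoid n) : Prop := ∃ z : BraidMonoid n, y = z * x

/-- A positive `n`-braid is simple if it is a left divisor of `Δ_n`. -/
def IsSimple {n : ℕ} (x : BraidMonoid n) : Prop := LeftDivides x (Delta n)

/-- The length homomorphism of `B_n^+`, sending every `σᵢ` to `1`. -/
def lengthHom (n : ℕ) : BraidMonoid n →* Multiplicative ℕ :=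
  PresentedMonoid.lift (fun _ => Multiplicative.ofAdd 1) (by
    intro a b h
    cases h <;> simp [mul_comm])

theorem lengthHom_mk {n : ℕ} (w : FreeMonoid (BraidGen n)) :
    (lengthHom n (PresentedMonoid.mk (BraidRel n) w)).toAdd = w.toList.length := by
  induction w using FreeMonoid.inductionOn' with
  | one => simp
  | of_mul i w ih =>
    have h : lengthHom n (PresentedMonoid.mk (BraidRel n) (FreeMonoid.of i))
        = Multiplicative.ofAdd 1 := PresentedMonoid.lift_of _ _
    rw [map_mul, map_mul, toAdd_mul, ih, h]
    simp [Nat.add_comm]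

/-- There are finitely many simple `n`-braids. -/
theorem finite_setOf_isSimple (n : ℕ) : {x : BraidMonoid n | IsSimple x}.Finite := by
  have hfin : Finite (BraidGen n) :=
    Set.Finite.to_subtype ((Set.finite_Iio n).subset fun _ h => h.2)
  have hw := (List.finite_length_le (BraidGen n) (lengthHom n (Delta n)).toAdd).image
    (fun l => PresentedMonoid.mk (BraidRel n) (FreeMonoid.ofList l))
  refine hw.subset ?_
  rintro x ⟨z, hz⟩
  obtain ⟨w, rfl⟩ := PresentedMonoid.surjective_mk x
  refine ⟨w.toList, ?_, by simp⟩
  have h := congrArg (fun y => (lengthHom n y).toAdd) hz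
  simp only [map_mul, toAdd_mul, lengthHom_mk] at h
  simp only [Set.mem_ofPred_eq]
  omega

/-- The finite set of simple `n`-braids. -/
noncomputable def simpleBraids (n : ℕ) : Finset (BraidMonoid n) :=
  (finite_setOf_isSimple n).toFinset

open Classical in
/-- `D_L(x)`: the set of all `i` in `{1, …, n-1}` such that `σᵢ` is a left divisor of `x`. -/
noncomputable def DL {n : ℕ} (x : BraidMonoid n) : Finset ℕ :=
  {i ∈ Finset.Icc 1 (n - 1) | ∃ h : 1 ≤ i ∧ i < n, LeftDivides (sigma ⟨i, h⟩) x}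

open Classical in
/-- `D_R(x)`: the set of all `i` in `{1, …, n-1}` such that `σᵢ` is a right divisor of `x`. -/
noncomputable def DR {n : ℕ} (x : BraidMonoid n) : Finset ℕ :=
  {i ∈ Finset.Icc 1 (n - 1) | ∃ h : 1 ≤ i ∧ i < n, RightDivides (sigma ⟨i, h⟩) x}

/-- `a_{n,I,J}`: the number of simple `n`-braids `x` with `D_L(x) = I` and `D_R(x) ⊇ J`. -/
noncomputable def a (n : ℕ) (I J : Finset ℕ) : ℕ :=
  Finset.card {x ∈ simpleBraids n | DL x = I ∧ J ⊆ DR x}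

/-- `â_{n,I,J}`: the number of simple `n`-braids `x` with `D_L(x) ⊇ I` and `D_R(x) ⊇ J`. -/
noncomputable def aHat (n : ℕ) (I J : Finset ℕ) : ℕ :=
  Finset.card {x ∈ simpleBraids n | I ⊆ DL x ∧ J ⊆ DR x}

/-- The `n`-composition `[I]_n = (p₁, p₂ - p₁, …, p_k - p_{k-1})`, where `p₁ < ⋯ < p_k` is the
increasing enumeration of `{1, …, n} \ I`. -/
def composition (n : ℕ) (I : Finset ℕ) : List ℕ :=
  let p := (Finset.Icc 1 n \ I).sort (· ≤ ·)
  List.zipWith (fun x y => x - y) p (0 :: p)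

/-- The `n`-partition `{I}_n`: the non-increasing rearrangement of `[I]_n`. -/
def partition (n : ℕ) (I : Finset ℕ) : List ℕ :=
  (composition n I).insertionSort (· ≥ ·)

end BraidMonoid

/-! Simple braids are the permutation braids. Call a positive braid reduced if its length equals the
number of inversions of its permutation. Each permutation has exactly one reduced lift
(`exists_reduced`, `Reduced.eq_of_perm_eq`), and the left divisors of `Delta n` are precisely the
reduced braids (`isSimple_iff_reduced`). For reduced `x`, the sets `DR x` and `DL x` are the
descents of `perm n x` and of its inverse, so `aHat n I J` counts the permutations in `descentPerms
n I J`.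

Such a permutation is decreasing on the blocks cut out by `J`, and its inverse on those cut out by
`I`. Each double coset of the two Young subgroups contains exactly one such permutation
(`exists_mem_descentPerms`, `eq_of_decreasingOnFibers`), so `aHat n I J` is a number of double
cosets. Sets with the same partition have conjugate Young subgroups (`exists_perm_block`), and
conjugating the two subgroups independently preserves the number of double cosets; this gives (i).

For (ii), `aHat n I J` is the sum of `a n K J` over `K ⊇ I`. This system is unitriangular in `I`, so
the `aHat` determine the `a`. -/

namespace BraidMonoid

open Equiv Finset

variable {n : ℕ}

/-! ### Adjacent transpositions and the braid relations -/

/-- The lower of the two adjacent positions exchanged by `σᵢ`. -/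
def lo (i : BraidGen n) : Fin n := ⟨i.1 - 1, by have := i.2; omega⟩

/-- The upper of the two adjacent positions exchanged by `σᵢ`. -/
def hi (i : BraidGen n) : Fin n := ⟨i.1, i.2.2⟩

/-- The adjacent transposition associated with `σᵢ`. -/
def adj (i : BraidGen n) : Perm (Fin n) := swap (lo i) (hi i)

theorem lo_lt_hi (i : BraidGen n) : lo i < hi i := by
  have := i.2
  simp only [lo, hi, Fin.mk_lt_mk]
  omega

theorem val_lo (i : BraidGen n) : (lo i).1 = i.1 - 1 := rfl

theorem val_hi (i : BraidGen n) : (hi i).1 = i.1 := rfl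

@[simp] theorem adj_lo (i : BraidGen n) : adj i (lo i) = hi i := swap_apply_left _ _

@[simp] theorem adj_hi (i : BraidGen n) : adj i (hi i) = lo i := swap_apply_right _ _

theorem adj_of_ne {i : BraidGen n} {a : Fin n} (h : a ≠ lo i) (h' : a ≠ hi i) : adj i a = a :=
  swap_apply_of_ne_of_ne h h'

@[simp] theorem adj_mul_self (i : BraidGen n) : adj i * adj i = 1 := swap_mul_self _ _

@[simp] theorem adj_adj (i : BraidGen n) (a : Fin n) : adj i (adj i a) = a := by
  rw [← Perm.mul_apply, adj_mul_self, Perm.one_apply]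

@[simp] theorem adj_inv (i : BraidGen n) : (adj i)⁻¹ = adj i := swap_inv _ _

theorem lo_ne_of_lt {i j : BraidGen n} (h : i.1 < j.1) : lo i ≠ lo j := by
  have := i.2; have := j.2
  simp only [lo, ne_eq, Fin.mk.injEq]; omega

theorem hi_ne_of_lt {i j : BraidGen n} (h : i.1 < j.1) : hi i ≠ hi j := by
  simp only [hi, ne_eq, Fin.mk.injEq]; omega

theorem lo_ne_hi_of_lt {i j : BraidGen n} (h : i.1 < j.1) : lo i ≠ hi j := by
  have := i.2
  simp only [lo, hi, ne_eq, Fin.mk.injEq]; omega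

theorem hi_ne_lo_of_lt {i j : BraidGen n} (h : i.1 + 2 ≤ j.1) : hi i ≠ lo j := by
  simp only [lo, hi, ne_eq, Fin.mk.injEq]; omega

theorem hi_eq_lo {i j : BraidGen n} (h : i.1 + 1 = j.1) : hi i = lo j := by
  simp only [lo, hi, Fin.mk.injEq]; omega

theorem adj_mul_comm {i j : BraidGen n} (h : i.1 + 2 ≤ j.1) : adj i * adj j = adj j * adj i := by
  have h' : i.1 < j.1 := by omega
  refine Perm.Disjoint.commute fun a => ?_
  by_cases h1 : a = lo i
  · right; rw [h1]; exact adj_of_ne (lo_ne_of_lt h') (lo_ne_hi_of_lt h')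
  by_cases h2 : a = hi i
  · right; rw [h2]; exact adj_of_ne (hi_ne_lo_of_lt h) (hi_ne_of_lt h')
  · left; exact adj_of_ne h1 h2

theorem adj_braid {i j : BraidGen n} (h : i.1 + 1 = j.1) :
    adj i * adj j * adj i = adj j * adj i * adj j := by
  have h' : i.1 < j.1 := by omega
  have h1 := lo_ne_of_lt h'
  have h2 := lo_ne_hi_of_lt h'
  have h3 := (lo_lt_hi j).ne
  unfold adj
  rw [hi_eq_lo h, swap_mul_swap_mul_swap h1 h2, swap_comm (lo i), swap_comm (lo j) (hi j),
    swap_mul_swap_mul_swap h3.symm h2.symm, swap_comm]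

theorem adj_lt_adj {i : BraidGen n} {a b : Fin n} (hab : a < b) (h : ¬(a = lo i ∧ b = hi i)) :
    adj i a < adj i b := by
  have := i.2
  unfold adj lo hi at *
  simp only [swap_apply_def]
  split_ifs <;> simp only [Fin.ext_iff, Fin.lt_def] at * <;> omega

/-! ### Inversions and descents of permutations -/

/-- The inversions of a permutation. -/
def inversions (w : Perm (Fin n)) : Finset (Fin n × Fin n) := {p | p.1 < p.2 ∧ w p.2 < w p.1}

/-- The number of inversions of a permutation. -/
def invCount (w : Perm (Fin n)) : ℕ := #(inversions w)

theorem mem_inversions {w : Perm (Fin n)} {p : Fin n × Fin n} :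
    p ∈ inversions w ↔ p.1 < p.2 ∧ w p.2 < w p.1 := by simp [inversions]

theorem invCount_one : invCount (1 : Perm (Fin n)) = 0 := by
  rw [invCount, Finset.card_eq_zero, Finset.eq_empty_iff_forall_notMem]
  intro p hp
  rw [mem_inversions] at hp
  exact lt_asymm hp.1 hp.2

theorem invCount_inv (w : Perm (Fin n)) : invCount w⁻¹ = invCount w := by
  refine Finset.card_bij' (fun p _ => (w⁻¹ p.2, w⁻¹ p.1)) (fun p _ => (w p.2, w p.1)) ?_ ?_ ?_ ?_
  all_goals simp +contextual [mem_inversions]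

/-- An adjacent transposition preserves the order of every pair of positions except the one it
exchanges, so exactly one inversion is created. -/
theorem inversions_mul_adj {w : Perm (Fin n)} {i : BraidGen n} (h : w (lo i) < w (hi i)) :
    inversions (w * adj i) =
      insert (lo i, hi i) ((inversions w).image (fun p => (adj i p.1, adj i p.2))) := by
  ext ⟨a, b⟩
  simp only [mem_insert, mem_image, mem_inversions, Perm.mul_apply, Prod.mk.injEq, Prod.exists]
  constructor
  · rintro ⟨h1, h2⟩
    by_cases hc : a = lo i ∧ b = hi i
    · exact Or.inl hc
    · exact Or.inr ⟨adj i a, adj i b, ⟨adj_lt_adj h1 hc, h2⟩, by simp, by simp⟩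
  · rintro (⟨rfl, rfl⟩ | ⟨a, b, ⟨h1, h2⟩, rfl, rfl⟩)
    · simpa using ⟨lo_lt_hi i, h⟩
    · refine ⟨adj_lt_adj h1 ?_, by simpa using h2⟩
      rintro ⟨rfl, rfl⟩
      exact lt_asymm h h2

theorem invCount_mul_adj_of_lt {w : Perm (Fin n)} {i : BraidGen n} (h : w (lo i) < w (hi i)) :
    invCount (w * adj i) = invCount w + 1 := by
  rw [invCount, inversions_mul_adj h, card_insert_of_notMem, card_image_of_injective, invCount]
  · rintro ⟨a, b⟩ ⟨c, d⟩ hh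
    simpa using hh
  · simp only [mem_image, mem_inversions, Prod.mk.injEq, Prod.exists, not_exists, not_and]
    rintro a b ⟨h1, -⟩ ha hb
    have ha' : a = hi i := by rw [← adj_adj i a, ha, adj_lo]
    have hb' : b = lo i := by rw [← adj_adj i b, hb, adj_hi]
    rw [ha', hb'] at h1
    exact lt_asymm h1 (lo_lt_hi i)

theorem invCount_mul_adj_of_gt {w : Perm (Fin n)} {i : BraidGen n} (h : w (hi i) < w (lo i)) :
    invCount (w * adj i) + 1 = invCount w := by
  rw [← invCount_mul_adj_of_lt (w := w * adj i) (i := i) (by simpa using h), mul_assoc,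
    adj_mul_self, mul_one]

theorem ne_apply (w : Perm (Fin n)) (i : BraidGen n) : w (lo i) ≠ w (hi i) :=
  fun h => (lo_lt_hi i).ne (w.injective h)

theorem invCount_mul_adj_le (w : Perm (Fin n)) (i : BraidGen n) :
    invCount (w * adj i) ≤ invCount w + 1 := by
  rcases (ne_apply w i).lt_or_gt with h | h
  · exact (invCount_mul_adj_of_lt h).le
  · have := invCount_mul_adj_of_gt h; omega

theorem eq_one_of_strictMono {w : Perm (Fin n)} (h : StrictMono w) : w = 1 := by
  have : (h.orderIsoOfSurjective w w.surjective) = OrderIso.refl _ := Subsingleton.elim _ _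
  ext a
  exact congrArg (fun f : Fin n ≃o Fin n => (f a : ℕ)) this

theorem exists_descent {w : Perm (Fin n)} (h : w ≠ 1) : ∃ i : BraidGen n, w (hi i) < w (lo i) := by
  by_contra! hc
  apply h
  apply eq_one_of_strictMono
  cases n with
  | zero => exact fun a => a.elim0
  | succ m =>
    refine Fin.strictMono_iff_lt_succ.2 fun k => ?_
    have h1 := hc ⟨k.1 + 1, by omega, by omega⟩
    exact lt_of_le_of_ne h1 (ne_apply w ⟨k.1 + 1, by omega, by omega⟩)

/-! ### Permutation and length of a braid; reduced braids -/

/-- The permutation underlying a positive braid. -/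
def perm (n : ℕ) : BraidMonoid n →* Perm (Fin n) :=
  PresentedMonoid.lift adj (by
    intro a b h
    cases h with
    | comm i j h => simpa using adj_mul_comm h
    | braid i j h => simpa using adj_braid h)

@[simp] theorem perm_sigma (i : BraidGen n) : perm n (sigma i) = adj i := PresentedMonoid.lift_of _ _

/-- The length of a positive braid. -/
def len (x : BraidMonoid n) : ℕ := (lengthHom n x).toAdd

@[simp] theorem len_one : len (1 : BraidMonoid n) = 0 := by simp [len]

@[simp] theorem len_mul (x y : BraidMonoid n) : len (x * y) = len x + len y := by simp [len]

@[simp] theorem len_sigma (i : BraidGen n) : len (sigma i) = 1 := by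
  have h : lengthHom n (sigma i) = Multiplicative.ofAdd 1 := PresentedMonoid.lift_of _ _
  simp [len, h]

theorem induction_left {P : BraidMonoid n → Prop} (one : P 1)
    (sigma_mul : ∀ i x, P x → P (sigma i * x)) (x : BraidMonoid n) : P x := by
  obtain ⟨w, rfl⟩ := PresentedMonoid.surjective_mk x
  induction w using FreeMonoid.inductionOn' with
  | one => simpa using one
  | of_mul i w ih => rw [map_mul]; exact sigma_mul i _ ih

theorem eq_one_or_mul_sigma (x : BraidMonoid n) : x = 1 ∨ ∃ y i, x = y * sigma i := by
  induction x using induction_left with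
  | one => exact Or.inl rfl
  | sigma_mul i x ih =>
    right
    rcases ih with rfl | ⟨y, j, rfl⟩
    · exact ⟨1, i, by simp⟩
    · exact ⟨sigma i * y, j, by rw [mul_assoc]⟩

theorem invCount_mul_perm_le (w : Perm (Fin n)) (x : BraidMonoid n) :
    invCount (w * perm n x) ≤ invCount w + len x := by
  induction x using induction_left generalizing w with
  | one => simp
  | sigma_mul i x ih =>
    have h1 := ih (w * adj i)
    have h2 := invCount_mul_adj_le w i
    rw [map_mul, perm_sigma, ← mul_assoc, len_mul, len_sigma]
    omega

theorem invCount_perm_le (x : BraidMonoid n) : invCount (perm n x) ≤ len x := by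
  simpa [invCount_one] using invCount_mul_perm_le 1 x

/-- A positive braid is reduced if it is as short as its permutation allows. -/
def Reduced (x : BraidMonoid n) : Prop := len x = invCount (perm n x)

theorem Reduced.of_mul_right {x y : BraidMonoid n} (h : Reduced (x * y)) : Reduced x := by
  have h1 := invCount_mul_perm_le (perm n x) y
  have h2 := invCount_perm_le x
  unfold Reduced at *
  rw [map_mul, len_mul] at h
  omega

theorem Reduced.descent {x : BraidMonoid n} {i : BraidGen n} (h : Reduced (x * sigma i)) :
    perm n (x * sigma i) (hi i) < perm n (x * sigma i) (lo i) := by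
  have hx := h.of_mul_right
  rw [map_mul, perm_sigma, Perm.mul_apply, Perm.mul_apply, adj_hi, adj_lo]
  refine lt_of_le_of_ne (not_lt.1 fun hlt => ?_) (ne_apply _ _)
  have := invCount_mul_adj_of_gt hlt
  unfold Reduced at *
  rw [map_mul, perm_sigma, len_mul, len_sigma] at h
  omega

theorem Reduced.mul_sigma {x : BraidMonoid n} {i : BraidGen n} (h : Reduced x)
    (hi' : perm n x (lo i) < perm n x (hi i)) : Reduced (x * sigma i) := by
  unfold Reduced at *
  rw [map_mul, perm_sigma, len_mul, len_sigma, invCount_mul_adj_of_lt hi', h]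

theorem exists_reduced (w : Perm (Fin n)) : ∃ x : BraidMonoid n, Reduced x ∧ perm n x = w := by
  induction hk : invCount w using Nat.strong_induction_on generalizing w with
  | _ k ih =>
    by_cases hw : w = 1
    · exact ⟨1, by simp [Reduced, invCount_one], by simp [hw]⟩
    · obtain ⟨i, hi'⟩ := exists_descent hw
      have h1 := invCount_mul_adj_of_gt hi'
      obtain ⟨x, hx, hxw⟩ := ih _ (by omega) (w * adj i) rfl
      refine ⟨x * sigma i, hx.mul_sigma (by simpa [hxw] using hi'), ?_⟩
      rw [map_mul, perm_sigma, hxw, mul_assoc, adj_mul_self, mul_one]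

/-! ### Uniqueness of reduced lifts -/

theorem sigma_mul_comm {i j : BraidGen n} (h : i.1 + 2 ≤ j.1) :
    sigma i * sigma j = sigma j * sigma i := by
  simpa [sigma, PresentedMonoid.of] using PresentedMonoid.mk_eq_mk_of_rel (BraidRel.comm i j h)

theorem sigma_braid {i j : BraidGen n} (h : i.1 + 1 = j.1) :
    sigma i * sigma j * sigma i = sigma j * sigma i * sigma j := by
  simpa [sigma, PresentedMonoid.of] using PresentedMonoid.mk_eq_mk_of_rel (BraidRel.braid i j h)

/-- Two descents of `w` allow the longest element of the rank-two subgroup they generate to be split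
off on the right. That element has one reduced word ending in each generator, and the two words
agree by a single defining relation. -/
theorem exists_common_reduced {w : Perm (Fin n)} {i j : BraidGen n} (hij : i.1 < j.1)
    (h1 : w (hi i) < w (lo i)) (h2 : w (hi j) < w (lo j)) :
    ∃ x y : BraidMonoid n, Reduced x ∧ Reduced y ∧ perm n x = w * adj i ∧ perm n y = w * adj j ∧
      x * sigma i = y * sigma j := by
  by_cases hc : i.1 + 2 ≤ j.1
  · have e1 : adj i (lo j) = lo j := adj_of_ne (lo_ne_of_lt hij).symm (hi_ne_lo_of_lt hc).symm
    have e2 : adj i (hi j) = hi j := adj_of_ne (lo_ne_hi_of_lt hij).symm (hi_ne_of_lt hij).symm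
    have e3 : adj j (lo i) = lo i := adj_of_ne (lo_ne_of_lt hij) (lo_ne_hi_of_lt hij)
    have e4 : adj j (hi i) = hi i := adj_of_ne (hi_ne_lo_of_lt hc) (hi_ne_of_lt hij)
    obtain ⟨z, hz, hzw⟩ := exists_reduced (w * adj i * adj j)
    refine ⟨z * sigma j, z * sigma i, hz.mul_sigma ?_, hz.mul_sigma ?_, ?_, ?_, ?_⟩
    · simpa [hzw, e1, e2] using h2
    · simpa [hzw, e3, e4] using h1
    · rw [map_mul, perm_sigma, hzw, mul_assoc, adj_mul_self, mul_one]
    · rw [map_mul, perm_sigma, hzw, mul_assoc w, adj_mul_comm hc, mul_assoc, mul_assoc,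
        adj_mul_self, mul_one]
    · rw [mul_assoc, mul_assoc, sigma_mul_comm hc]
  · have hs : i.1 + 1 = j.1 := by omega
    have e0 := hi_eq_lo hs
    have e1 : adj i (hi j) = hi j := adj_of_ne (lo_ne_hi_of_lt hij).symm (hi_ne_of_lt hij).symm
    have e2 : adj j (lo i) = lo i := adj_of_ne (lo_ne_of_lt hij) (lo_ne_hi_of_lt hij)
    have e3 : adj i (lo j) = lo i := by rw [← e0, adj_hi]
    have e4 : adj j (hi i) = hi j := by rw [e0, adj_lo]
    have h3 : w (hi j) < w (lo i) := h2.trans (by rw [← e0]; exact h1)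
    obtain ⟨z, hz, hzw⟩ := exists_reduced (w * adj i * adj j * adj i)
    have hzi : Reduced (z * sigma i) := hz.mul_sigma (by simpa [hzw, e0, e1, e2, e3, e4] using h2)
    have hzj : Reduced (z * sigma j) := hz.mul_sigma (by
      simpa [hzw, e0, e1, e2, e3, e4] using e0 ▸ h1)
    refine ⟨z * sigma i * sigma j, z * sigma j * sigma i, hzi.mul_sigma ?_, hzj.mul_sigma ?_,
      ?_, ?_, ?_⟩
    · simpa [hzw, e0, e1, e2, e3, e4] using h3
    · simpa [hzw, e0, e1, e2, e3, e4] using h3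
    · simp only [map_mul, perm_sigma, hzw]
      rw [mul_assoc _ (adj i) (adj i), adj_mul_self, mul_one, mul_assoc _ (adj j), adj_mul_self,
        mul_one]
    · simp only [map_mul, perm_sigma, hzw]
      rw [mul_assoc w, mul_assoc w, adj_braid hs, mul_assoc w, mul_assoc _ (adj j) (adj j),
        adj_mul_self, mul_one, mul_assoc w, mul_assoc _ (adj i) (adj i), adj_mul_self, mul_one]
    · simpa only [mul_assoc] using congrArg (z * ·) (sigma_braid hs)

/-- Matsumoto's argument, by induction on length: when the last letters differ, both are descents of
the common permutation, and `exists_common_reduced` supplies an intermediate braid that can end in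
either letter. -/
theorem Reduced.eq_of_perm_eq {x y : BraidMonoid n} (hx : Reduced x) (hy : Reduced y)
    (h : perm n x = perm n y) : x = y := by
  induction hk : len x using Nat.strong_induction_on generalizing x y with
  | _ k ih =>
    have hlen : len x = len y := by rw [hx, hy, h]
    rcases eq_one_or_mul_sigma x with rfl | ⟨x, i, rfl⟩ <;>
      rcases eq_one_or_mul_sigma y with rfl | ⟨y, j, rfl⟩
    · rfl
    · simp at hlen
    · simp at hlen
    · have key : ∀ {x y : BraidMonoid n} {i j : BraidGen n}, i.1 < j.1 → len (x * sigma i) = k →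
          len (y * sigma j) = k → Reduced (x * sigma i) → Reduced (y * sigma j) →
          perm n (x * sigma i) = perm n (y * sigma j) → x * sigma i = y * sigma j := by
        intro x y i j hij hkx hky hx hy h
        obtain ⟨x', y', hx', hy', hpx, hpy, hxy⟩ :=
          exists_common_reduced hij hx.descent (h ▸ hy.descent)
        have ex : x = x' := ih (len x) (by simp at hkx; omega) hx.of_mul_right hx'
          (by rw [hpx, map_mul, perm_sigma, mul_assoc, adj_mul_self, mul_one]) rfl
        have ey : y = y' := ih (len y) (by simp at hky; omega) hy.of_mul_right hy'
          (by rw [hpy, h, map_mul, perm_sigma, mul_assoc, adj_mul_self, mul_one]) rfl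
        rw [ex, ey, hxy]
      rcases lt_trichotomy i.1 j.1 with hij | hij | hij
      · exact key hij hk (hlen ▸ hk) hx hy h
      · obtain rfl : i = j := Subtype.ext hij
        rw [ih (len x) (by simp at hk; omega) hx.of_mul_right hy.of_mul_right ?_ rfl]
        simpa using h
      · exact (key hij (hlen ▸ hk) hk hy hx h.symm).symm

/-! ### Divisibility by generators as descents -/

theorem rightDivides_sigma_iff {x : BraidMonoid n} (hx : Reduced x) (i : BraidGen n) :
    RightDivides (sigma i) x ↔ perm n x (hi i) < perm n x (lo i) := by
  constructor
  · rintro ⟨z, rfl⟩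
    exact hx.descent
  · intro h
    obtain ⟨z, hz, hzw⟩ := exists_reduced (perm n x * adj i)
    refine ⟨z, hx.eq_of_perm_eq (hz.mul_sigma (by simpa [hzw] using h)) ?_⟩
    rw [map_mul, perm_sigma, hzw, mul_assoc, adj_mul_self, mul_one]

theorem invCount_adj_mul (w : Perm (Fin n)) (i : BraidGen n) :
    invCount (adj i * w) = invCount (w⁻¹ * adj i) := by
  rw [← invCount_inv, mul_inv_rev, adj_inv]

theorem leftDivides_sigma_iff {x : BraidMonoid n} (hx : Reduced x) (i : BraidGen n) :
    LeftDivides (sigma i) x ↔ (perm n x)⁻¹ (hi i) < (perm n x)⁻¹ (lo i) := by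
  constructor
  · rintro ⟨z, rfl⟩
    refine lt_of_le_of_ne (not_lt.1 fun hlt => ?_) (ne_apply _ i).symm
    have h1 := invCount_mul_adj_of_lt hlt
    rw [← invCount_adj_mul, invCount_inv, map_mul, perm_sigma, ← mul_assoc, adj_mul_self, one_mul] at h1
    have h2 := invCount_perm_le z
    unfold Reduced at hx
    rw [map_mul, perm_sigma, len_mul, len_sigma] at hx
    omega
  · intro h
    obtain ⟨z, hz, hzw⟩ := exists_reduced (adj i * perm n x)
    have h1 := invCount_mul_adj_of_gt h
    rw [← invCount_adj_mul, invCount_inv, ← hzw] at h1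
    have e : perm n (sigma i * z) = perm n x := by
      rw [map_mul, perm_sigma, hzw, ← mul_assoc, adj_mul_self, one_mul]
    refine ⟨z, hx.eq_of_perm_eq ?_ e.symm⟩
    unfold Reduced at *
    rw [e, len_mul, len_sigma]
    omega

/-! ### Permutation and length of `Delta n` -/

theorem perm_incl_castSucc (x : BraidMonoid n) (k : Fin n) :
    perm (n + 1) (incl n x) k.castSucc = (perm n x k).castSucc := by
  induction x using induction_left generalizing k with
  | one => simp
  | sigma_mul i x ih =>
    have h : incl n (sigma i) = sigma ⟨i.1, i.2.1, Nat.lt_succ_of_lt i.2.2⟩ :=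
      PresentedMonoid.lift_of _ _
    rw [map_mul, map_mul, map_mul, h, perm_sigma, perm_sigma, Perm.mul_apply, Perm.mul_apply, ih]
    exact ((Fin.castSucc_injective n).map_swap (lo i) (hi i) _).symm

theorem perm_incl_last (x : BraidMonoid n) :
    perm (n + 1) (incl n x) (Fin.last n) = Fin.last n := by
  induction x using induction_left with
  | one => simp
  | sigma_mul i x ih =>
    have h : incl n (sigma i) = sigma ⟨i.1, i.2.1, Nat.lt_succ_of_lt i.2.2⟩ :=
      PresentedMonoid.lift_of _ _
    rw [map_mul, map_mul, h, perm_sigma, Perm.mul_apply, ih]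
    have := i.2
    apply adj_of_ne <;> simp only [ne_eq, Fin.ext_iff, val_lo, val_hi, Fin.val_last] <;> omega

theorem len_incl (x : BraidMonoid n) : len (incl n x) = len x := by
  induction x using induction_left with
  | one => simp
  | sigma_mul i x ih =>
    have h : incl n (sigma i) = sigma ⟨i.1, i.2.1, Nat.lt_succ_of_lt i.2.2⟩ :=
      PresentedMonoid.lift_of _ _
    rw [map_mul, len_mul, len_mul, h, len_sigma, len_sigma, ih]

/-- The braid `σ₁ σ₂ ⋯ σ_n` on `n + 1` strands. -/
def ascendingProd (n : ℕ) : BraidMonoid (n + 1) :=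
  (List.ofFn fun k : Fin n =>
    sigma (n := n + 1) ⟨k.1 + 1, Nat.succ_pos _, Nat.succ_lt_succ k.2⟩).prod

theorem Delta_succ (n : ℕ) : Delta (n + 1) = ascendingProd n * incl n (Delta n) := rfl

theorem ascendingProd_succ (n : ℕ) :
    ascendingProd (n + 1) = incl (n + 1) (ascendingProd n) *
      sigma ⟨n + 1, Nat.succ_pos _, Nat.lt_succ_self _⟩ := by
  rw [ascendingProd, List.ofFn_succ_last, List.prod_append, List.prod_singleton, ascendingProd,
    map_list_prod, List.map_ofFn]
  rfl

theorem len_ascendingProd (n : ℕ) : len (ascendingProd n) = n := by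
  induction n with
  | zero => simp [ascendingProd]
  | succ n ih => rw [ascendingProd_succ, len_mul, len_incl, len_sigma, ih]

theorem perm_ascendingProd (n : ℕ) : perm (n + 1) (ascendingProd n) = finRotate (n + 1) := by
  induction n with
  | zero => exact Equiv.ext fun k => Subsingleton.elim (α := Fin 1) _ _
  | succ n ih =>
    ext k
    rw [ascendingProd_succ, map_mul, perm_sigma, Perm.mul_apply]
    set i : BraidGen (n + 2) := ⟨n + 1, Nat.succ_pos _, Nat.lt_succ_self _⟩
    have hlo : lo i = (Fin.last n).castSucc := rfl
    have hhi : hi i = Fin.last (n + 1) := rfl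
    induction k using Fin.lastCases with
    | last => rw [← hhi, adj_hi, hlo, perm_incl_castSucc, ih, hhi, finRotate_last, finRotate_last]; rfl
    | cast k =>
      induction k using Fin.lastCases with
      | last =>
        rw [← hlo, adj_lo, hhi, perm_incl_last, hlo, coe_finRotate_of_ne_last]
        · rfl
        · exact (Fin.castSucc_lt_last _).ne
      | cast k =>
        rw [adj_of_ne, perm_incl_castSucc, ih, coe_finRotate_of_ne_last, Fin.val_castSucc,
          coe_finRotate_of_ne_last]
        · rfl
        · exact (Fin.castSucc_lt_last _).ne
        · exact (Fin.castSucc_lt_last _).ne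
        · rw [hlo]; exact fun h => (Fin.castSucc_lt_last k).ne (Fin.castSucc_injective _ h)
        · rw [hhi]; exact (Fin.castSucc_lt_last _).ne

theorem perm_Delta (n : ℕ) : perm n (Delta n) = Fin.revPerm := by
  induction n with
  | zero => exact Subsingleton.elim _ _
  | succ n ih =>
    ext k
    rw [Delta_succ, map_mul, perm_ascendingProd, Perm.mul_apply]
    induction k using Fin.lastCases with
    | last => rw [perm_incl_last, finRotate_last]; simp
    | cast k =>
      rw [perm_incl_castSucc, ih, coe_finRotate_of_ne_last (Fin.castSucc_lt_last _).ne]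
      simp [Fin.val_rev]
      omega

theorem len_Delta (n : ℕ) : len (Delta n) = ∑ k ∈ range n, k := by
  induction n with
  | zero => exact len_one
  | succ n ih => rw [Delta_succ, len_mul, len_ascendingProd, len_incl, ih, sum_range_succ, add_comm]

/-! ### Simple braids are the reduced braids -/

theorem card_pairs_lt (n : ℕ) : #{p : Fin n × Fin n | p.1 < p.2} = ∑ k ∈ range n, k := by
  rw [card_filter, ← univ_product_univ, sum_product_right, ← Fin.sum_univ_eq_sum_range (fun k => k)]
  refine sum_congr rfl fun b _ => ?_
  rw [← card_filter, ← Fin.card_Iio b]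
  congr 1
  ext
  simp

/-- Reversing the positions exchanges inversions and non-inversions. -/
theorem invCount_add_invCount_mul_rev (w : Perm (Fin n)) :
    invCount w + invCount (w * Fin.revPerm) = ∑ k ∈ range n, k := by
  rw [← card_pairs_lt, ← card_filter_add_card_filter_not (s := {p : Fin n × Fin n | p.1 < p.2})
    (fun p => w p.2 < w p.1)]
  congr 1
  · rw [filter_filter]; rfl
  · refine card_bij' (fun p _ => (p.2.rev, p.1.rev)) (fun p _ => (p.2.rev, p.1.rev)) ?_ ?_ ?_ ?_
    · rintro ⟨a, b⟩ h
      simp only [mem_inversions, Perm.mul_apply, Fin.revPerm_apply] at h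
      simpa using ⟨h.1, h.2.le⟩
    · rintro ⟨a, b⟩ h
      simp only [mem_filter, mem_univ, true_and, not_lt] at h
      simp only [mem_inversions, Perm.mul_apply, Fin.revPerm_apply, Fin.rev_rev, Fin.rev_lt_rev]
      exact ⟨h.1, lt_of_le_of_ne h.2 fun he => h.1.ne (w.injective he)⟩
    · simp
    · simp

/-- `Delta n` is the reduced lift of the reversal. In a factorization `x * z` of it, subadditivity
of inversions leaves no slack, so `x` is reduced; conversely, the complementary permutation has a
reduced lift, and the inversion counts add up to the length of `Delta n`. -/
theorem isSimple_iff_reduced (x : BraidMonoid n) : IsSimple x ↔ Reduced x := by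
  have h0 := invCount_add_invCount_mul_rev (1 : Perm (Fin n))
  rw [invCount_one, one_mul, zero_add] at h0
  constructor
  · rintro ⟨z, hz⟩
    have h1 := invCount_mul_perm_le (perm n x) z
    have h2 := invCount_perm_le x
    have h3 : len x + len z = ∑ k ∈ range n, k := by rw [← len_mul, ← hz, len_Delta]
    rw [← map_mul, ← hz, perm_Delta, h0] at h1
    unfold Reduced
    omega
  · intro hx
    obtain ⟨z, hz, hzw⟩ := exists_reduced ((perm n x)⁻¹ * Fin.revPerm)
    have e : perm n (x * z) = Fin.revPerm := by rw [map_mul, hzw, mul_inv_cancel_left]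
    have h1 := invCount_add_invCount_mul_rev (perm n x)⁻¹
    refine ⟨z, Reduced.eq_of_perm_eq ?_ ?_ ?_⟩
    · rw [Reduced, len_Delta, perm_Delta, h0]
    · unfold Reduced at *
      rw [e, h0, ← h1, len_mul, invCount_inv, hx, hz, hzw]
    · rw [perm_Delta, e]

/-! ### From counting braids to counting permutations by descents -/

/-- The descents of `w`: those `i` for which `w` reverses the adjacent positions of `σᵢ`. -/
def descents (w : Perm (Fin n)) : Set ℕ :=
  {i | ∃ h : 1 ≤ i ∧ i < n, w (hi ⟨i, h⟩) < w (lo ⟨i, h⟩)}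

theorem mem_DL_iff {x : BraidMonoid n} (hx : Reduced x) (i : ℕ) :
    i ∈ DL x ↔ i ∈ descents (perm n x)⁻¹ := by
  simp only [DL, mem_filter, leftDivides_sigma_iff hx, descents, Set.mem_ofPred_eq, mem_Icc,
    and_iff_right_iff_imp]
  rintro ⟨h, -⟩
  omega

theorem mem_DR_iff {x : BraidMonoid n} (hx : Reduced x) (i : ℕ) :
    i ∈ DR x ↔ i ∈ descents (perm n x) := by
  simp only [DR, mem_filter, rightDivides_sigma_iff hx, descents, Set.mem_ofPred_eq, mem_Icc,
    and_iff_right_iff_imp]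
  rintro ⟨h, -⟩
  omega

open Classical in
/-- The permutations whose inverse has a descent at each element of `I`, and which have a descent
at each element of `J`. -/
noncomputable def descentPerms (n : ℕ) (I J : Finset ℕ) : Finset (Perm (Fin n)) :=
  {w | ↑I ⊆ descents w⁻¹ ∧ ↑J ⊆ descents w}

theorem mem_descentPerms {I J : Finset ℕ} {w : Perm (Fin n)} :
    w ∈ descentPerms n I J ↔ ↑I ⊆ descents w⁻¹ ∧ ↑J ⊆ descents w := by
  classical simp [descentPerms]

theorem mem_simpleBraids {x : BraidMonoid n} : x ∈ simpleBraids n ↔ Reduced x := by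
  rw [simpleBraids, Set.Finite.mem_toFinset, Set.mem_ofPred_eq, isSimple_iff_reduced]

theorem aHat_eq_card_descentPerms (n : ℕ) (I J : Finset ℕ) : aHat n I J = #(descentPerms n I J) := by
  have key : ∀ {x : BraidMonoid n}, Reduced x →
      ((I ⊆ DL x ∧ J ⊆ DR x) ↔ perm n x ∈ descentPerms n I J) := by
    intro x hx
    rw [mem_descentPerms]
    simp only [Finset.subset_iff, Set.subset_def, mem_DL_iff hx, mem_DR_iff hx, mem_coe]
  refine card_nbij (perm n) ?_ ?_ ?_
  · intro x hx
    rw [mem_coe, mem_filter, mem_simpleBraids] at hx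
    exact (key hx.1).1 hx.2
  · intro x hx y hy h
    rw [mem_coe, mem_filter, mem_simpleBraids] at hx hy
    exact hx.1.eq_of_perm_eq hy.1 h
  · intro w hw
    obtain ⟨x, hx, rfl⟩ := exists_reduced w
    refine ⟨x, ?_, rfl⟩
    rw [mem_coe, mem_filter, mem_simpleBraids]
    exact ⟨hx, (key hx).2 hw⟩

/-! ### Recovering `a` from `aHat` -/

theorem DL_subset (x : BraidMonoid n) : DL x ⊆ Icc 1 (n - 1) := by
  classical exact filter_subset _ _

theorem aHat_eq_sum (n : ℕ) (I J : Finset ℕ) :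
    aHat n I J = ∑ K ∈ (Icc 1 (n - 1)).powerset with I ⊆ K, a n K J := by
  classical
  rw [aHat, card_eq_sum_card_fiberwise (f := DL) (t := {K ∈ (Icc 1 (n - 1)).powerset | I ⊆ K})]
  · refine sum_congr rfl fun K hK => ?_
    rw [mem_filter] at hK
    rw [a, filter_filter]
    congr 1
    refine filter_congr fun x _ => ?_
    constructor
    · rintro ⟨⟨-, h⟩, rfl⟩; exact ⟨rfl, h⟩
    · rintro ⟨rfl, h⟩; exact ⟨⟨hK.2, h⟩, rfl⟩
  · intro x hx
    rw [mem_coe, mem_filter] at hx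
    rw [mem_coe, mem_filter, mem_powerset]
    exact ⟨DL_subset x, hx.2.1⟩

/-- If all the `aHat n I J` and `aHat n I J'` agree, then so do all the `a n I J` and `a n I J'`. -/
theorem a_eq_of_aHat_eq {J J' : Finset ℕ}
    (h : ∀ I ⊆ Icc 1 (n - 1), aHat n I J = aHat n I J') (I : Finset ℕ) (hI : I ⊆ Icc 1 (n - 1)) :
    a n I J = a n I J' := by
  classical
  -- Downward induction on `I`: every term with `K ≠ I` in the sum for `aHat n I J` has `K` strictly
  -- larger.
  induction hk : #(Icc 1 (n - 1) \ I) using Nat.strong_induction_on generalizing I with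
  | _ k ih =>
    have hmem : I ∈ {K ∈ (Icc 1 (n - 1)).powerset | I ⊆ K} := by simp [hI]
    have := h I hI
    rw [aHat_eq_sum, aHat_eq_sum, ← add_sum_erase _ _ hmem, ← add_sum_erase _ _ hmem,
      sum_congr rfl (g := fun K => a n K J')] at this
    · exact Nat.add_right_cancel this
    · intro K hK
      rw [mem_erase, mem_filter, mem_powerset] at hK
      refine ih _ ?_ K hK.2.1 rfl
      rw [← hk]
      apply card_lt_card
      have hIK : I ⊂ K := lt_of_le_of_ne hK.2.2 hK.1.symm
      obtain ⟨q, hqK, hqI⟩ := exists_of_ssubset hIK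
      refine (ssubset_iff_of_subset (sdiff_subset_sdiff le_rfl hK.2.2)).2 ⟨q, ?_, ?_⟩
      · exact mem_sdiff.2 ⟨hK.2.1 hqK, hqI⟩
      · exact fun h => (mem_sdiff.1 h).2 hqK

/-! ### Double cosets of fibre stabilizers -/

/-- The permutations that preserve the fibres of `b`. -/
def fiberStabilizer (b : Fin n → ℕ) : Subgroup (Perm (Fin n)) where
  carrier := {u | ∀ x, b (u x) = b x}
  mul_mem' {u v} hu hv x := by rw [Perm.mul_apply, hu, hv]
  one_mem' _ := rfl
  inv_mem' {u} hu x := by rw [← hu, ← Perm.mul_apply, mul_inv_cancel, Perm.one_apply]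

theorem conj_mem_fiberStabilizer {b c : Fin n → ℕ} {τ u : Perm (Fin n)}
    (h : ∀ x y, b (τ x) = b (τ y) ↔ c x = c y) (hu : u ∈ fiberStabilizer b) :
    τ⁻¹ * u * τ ∈ fiberStabilizer c := by
  intro x
  rw [← h, Perm.mul_apply, Perm.mul_apply, ← Perm.mul_apply τ, mul_inv_cancel, Perm.one_apply]
  exact hu _

/-- `w` is decreasing on each fibre of `b`. -/
def DecreasingOnFibers (b : Fin n → ℕ) (w : Perm (Fin n)) : Prop :=
  ∀ x y, x < y → b x = b y → w y < w x

/-- A double coset of two fibre stabilizers contains at most one permutation that is decreasing on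
fibres together with its inverse. -/
theorem eq_of_decreasingOnFibers {b c : Fin n → ℕ} (hb : Monotone b) (hc : Monotone c)
    {w u v : Perm (Fin n)} (hu : u ∈ fiberStabilizer c) (hv : v ∈ fiberStabilizer b)
    (h1 : DecreasingOnFibers b w) (h2 : DecreasingOnFibers c w⁻¹)
    (h3 : DecreasingOnFibers b (u * w * v)) (h4 : DecreasingOnFibers c (u * w * v)⁻¹) :
    u * w * v = w := by
  have hcw : ∀ x, c (w (v x)) = c (w x) := by
    -- Both `F` and its rearrangement `F ∘ v` are sorted, hence equal; the second coordinate is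
    -- reversed because `w` and `u * w * v` decrease on the fibres of `b`.
    let F : Fin n → ℕ ×ₗ ℕᵒᵈ := fun x => toLex (b x, OrderDual.toDual (c (w x)))
    have hF1 : Monotone (F ∘ (1 : Perm (Fin n))) := by
      intro x y hxy
      rcases hxy.eq_or_lt with rfl | hlt
      · rfl
      rcases (hb hxy).lt_or_eq with h | h
      · exact (Prod.Lex.toLex_le_toLex).2 (Or.inl h)
      · exact (Prod.Lex.toLex_le_toLex).2 (Or.inr ⟨h, hc (h1 x y hlt h).le⟩)
    have hF2 : Monotone (F ∘ v) := by
      intro x y hxy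
      rcases hxy.eq_or_lt with rfl | hlt
      · rfl
      rcases (hb hxy).lt_or_eq with h | h
      · exact (Prod.Lex.toLex_le_toLex).2 (Or.inl (by simpa only [hv x, hv y] using h))
      · refine (Prod.Lex.toLex_le_toLex).2 (Or.inr ⟨by simpa only [hv x, hv y] using h, ?_⟩)
        have := hc (h3 x y hlt h).le
        rwa [Perm.mul_apply, Perm.mul_apply, Perm.mul_apply, Perm.mul_apply, hu, hu] at this
    intro x
    have := congrFun (Tuple.unique_monotone hF2 hF1) x
    exact congrArg OrderDual.ofDual (congrArg (fun p => (ofLex p).2) this)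
  set w' := u * w * v with hw'
  have hmem : ∀ x, c (w' (w⁻¹ x)) = c x := by
    intro x
    rw [hw', Perm.mul_apply, Perm.mul_apply, hu, hcw, ← Perm.mul_apply w, mul_inv_cancel,
      Perm.one_apply]
  -- This permutation preserves the fibres of `c`. Across fibres it is increasing by monotonicity of
  -- `c`; within one, because both inverses are decreasing there.
  have hmono : StrictMono (w' * w⁻¹) := by
    intro x y hxy
    rcases (hc hxy.le).lt_or_eq with h | h
    · rw [← hmem x, ← hmem y] at h
      exact hc.reflect_lt h
    · have h5 := h2 x y hxy h
      by_contra hle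
      have hlt : (w' * w⁻¹) y < (w' * w⁻¹) x :=
        lt_of_le_of_ne (not_lt.1 hle) fun he => hxy.ne' ((w' * w⁻¹).injective he)
      have h6 := h4 _ _ hlt (by
        change c (w' (w⁻¹ y)) = c (w' (w⁻¹ x))
        rw [hmem, hmem, h])
      rw [← Perm.mul_apply, ← Perm.mul_apply, inv_mul_cancel_left] at h6
      exact lt_asymm h5 h6
  exact mul_inv_eq_one.1 (eq_one_of_strictMono hmono)

/-! ### Blocks, and the double cosets of their stabilizers -/

/-- The index of the block of consecutive positions containing `x`, for the partition of the
positions into blocks given by the composition of `n` attached to `I`. -/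
def block (n : ℕ) (I : Finset ℕ) (x : Fin n) : ℕ := #{q ∈ Icc 1 n \ I | q ≤ x.1}

theorem block_mono (I : Finset ℕ) : Monotone (block n I) := fun _ _ h =>
  card_le_card (monotone_filter_right _ fun _ _ hq => hq.trans h)

theorem block_lo_eq {I : Finset ℕ} {i : BraidGen n} (h : i.1 ∈ I) :
    block n I (lo i) = block n I (hi i) := by
  unfold block
  congr 1
  refine filter_congr fun q hq => ?_
  rw [mem_sdiff] at hq
  have : q ≠ i.1 := by rintro rfl; exact hq.2 h
  rw [val_lo, val_hi]
  omega

theorem mem_of_block_lo_eq {I : Finset ℕ} {i : BraidGen n} (h : block n I (lo i) = block n I (hi i)) :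
    i.1 ∈ I := by
  by_contra hi'
  have := i.2
  refine h.not_lt (card_lt_card ?_)
  rw [Finset.ssubset_iff_of_subset
    (monotone_filter_right _ fun _ _ hq => hq.trans (Fin.le_def.1 (lo_lt_hi i).le))]
  refine ⟨i.1, mem_filter.2 ⟨mem_sdiff.2 ⟨mem_Icc.2 (by omega), hi'⟩, le_rfl⟩, fun h => ?_⟩
  have := (mem_filter.1 h).2
  rw [val_lo] at this
  omega

theorem adj_mem_fiberStabilizer {I : Finset ℕ} {i : BraidGen n} (h : i.1 ∈ I) :
    adj i ∈ fiberStabilizer (block n I) := by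
  intro x
  by_cases h1 : x = lo i
  · rw [h1, adj_lo, block_lo_eq h]
  by_cases h2 : x = hi i
  · rw [h2, adj_hi, block_lo_eq h]
  rw [adj_of_ne h1 h2]

theorem decreasingOnFibers_block {I : Finset ℕ} {w : Perm (Fin n)} (h : ↑I ⊆ descents w) :
    DecreasingOnFibers (block n I) w := by
  have key : ∀ d : ℕ, ∀ x y : Fin n, y.1 = x.1 + d + 1 → block n I x = block n I y → w y < w x := by
    intro d
    induction d with
    | zero =>
      intro x y hy hb
      have hlo : lo (⟨y.1, by omega, y.2⟩ : BraidGen n) = x := Fin.ext (by change y.1 - 1 = x.1; omega)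
      have hhi : hi (⟨y.1, by omega, y.2⟩ : BraidGen n) = y := rfl
      obtain ⟨h1, h2⟩ := h (mem_of_block_lo_eq (by rw [hlo, hhi, hb]))
      rwa [hlo, hhi] at h2
    | succ d ih =>
      intro x y hy hb
      have hxz : x ≤ ⟨x.1 + d + 1, by omega⟩ := Fin.le_def.2 (by simp only; omega)
      have hzy : ⟨x.1 + d + 1, by omega⟩ ≤ y := Fin.le_def.2 (by simp only; omega)
      have e := le_antisymm (block_mono I hxz) (hb ▸ block_mono I hzy)
      have h1 := ih x ⟨x.1 + d + 1, by omega⟩ rfl e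
      have hlo : lo (⟨y.1, by omega, y.2⟩ : BraidGen n) = ⟨x.1 + d + 1, by omega⟩ :=
        Fin.ext (by change y.1 - 1 = x.1 + d + 1; omega)
      have hhi : hi (⟨y.1, by omega, y.2⟩ : BraidGen n) = y := rfl
      obtain ⟨h2, h3⟩ := h (mem_of_block_lo_eq (by rw [hlo, hhi, ← e, hb]))
      rw [hlo, hhi] at h3
      exact h3.trans h1
  intro x y hxy
  exact key (y.1 - x.1 - 1) x y (by have := Fin.lt_def.1 hxy; omega)

/-- Every double coset of the block stabilizers contains an element of `descentPerms n I J`. -/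
theorem exists_mem_descentPerms {I J : Finset ℕ} (hI : I ⊆ Icc 1 (n - 1)) (hJ : J ⊆ Icc 1 (n - 1))
    (w : Perm (Fin n)) : ∃ u ∈ fiberStabilizer (block n I), ∃ v ∈ fiberStabilizer (block n J),
      u * w * v ∈ descentPerms n I J := by
  classical
  -- Take an element of the double coset with the most inversions: at a missing descent, multiplying
  -- by the adjacent transposition would stay in the coset and add an inversion.
  obtain ⟨⟨u, v⟩, huv, hmax⟩ := exists_max_image
    {p : Perm (Fin n) × Perm (Fin n) | p.1 ∈ fiberStabilizer (block n I) ∧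
      p.2 ∈ fiberStabilizer (block n J)} (fun p => invCount (p.1 * w * p.2))
    ⟨1, by simp [one_mem]⟩
  simp only [mem_filter, mem_univ, true_and, Prod.forall] at huv hmax
  refine ⟨u, huv.1, v, huv.2, mem_descentPerms.2 ⟨fun i hi => ?_, fun j hj => ?_⟩⟩
  · have hi' := mem_Icc.1 (hI hi)
    have hin : 1 ≤ i ∧ i < n := by omega
    refine ⟨hin, lt_of_le_of_ne (not_lt.1 fun hlt => ?_) (ne_apply _ _).symm⟩
    have h1 := invCount_mul_adj_of_lt hlt
    have h2 := hmax (adj ⟨i, hin⟩ * u) v ⟨mul_mem (adj_mem_fiberStabilizer hi) huv.1, huv.2⟩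
    rw [← invCount_adj_mul, invCount_inv] at h1
    simp only [mul_assoc] at h1 h2
    omega
  · have hj' := mem_Icc.1 (hJ hj)
    have hjn : 1 ≤ j ∧ j < n := by omega
    refine ⟨hjn, lt_of_le_of_ne (not_lt.1 fun hlt => ?_) (ne_apply _ _).symm⟩
    have h1 := invCount_mul_adj_of_lt hlt
    have h2 := hmax u (v * adj ⟨j, hjn⟩) ⟨huv.1, mul_mem huv.2 (adj_mem_fiberStabilizer hj)⟩
    simp only [mul_assoc] at h1 h2
    omega

/-- Translating by `τ` and `σ⁻¹` carries double cosets for `I', J'` to double cosets for `I, J`. If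
`w₁` and `w₂` are sent to the same representative, they share a double coset for `I', J'`, hence
coincide. -/
theorem card_descentPerms_le {I I' J J' : Finset ℕ} (hI : I ⊆ Icc 1 (n - 1))
    (hJ : J ⊆ Icc 1 (n - 1)) {τ σ : Perm (Fin n)}
    (hτ : ∀ x y, block n I (τ x) = block n I (τ y) ↔ block n I' x = block n I' y)
    (hσ : ∀ x y, block n J (σ x) = block n J (σ y) ↔ block n J' x = block n J' y) :
    #(descentPerms n I' J') ≤ #(descentPerms n I J) := by
  choose u hu v hv huv using fun w => exists_mem_descentPerms hI hJ (τ * w * σ⁻¹)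
  refine card_le_card_of_injOn _ (fun w _ => huv w) fun w₁ h₁ w₂ h₂ h => ?_
  rw [mem_coe, mem_descentPerms] at h₁ h₂
  have e : (τ⁻¹ * ((u w₂)⁻¹ * u w₁) * τ) * w₁ * (σ⁻¹ * (v w₁ * (v w₂)⁻¹) * σ) = w₂ := by
    calc _ = τ⁻¹ * (u w₂)⁻¹ * (u w₁ * (τ * w₁ * σ⁻¹) * v w₁) * (v w₂)⁻¹ * σ := by group
      _ = w₂ := by rw [h]; group
  have := eq_of_decreasingOnFibers (block_mono J') (block_mono I')
    (conj_mem_fiberStabilizer hτ (mul_mem (inv_mem (hu w₂)) (hu w₁)))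
    (conj_mem_fiberStabilizer hσ (mul_mem (hv w₁) (inv_mem (hv w₂))))
    (decreasingOnFibers_block h₁.2) (decreasingOnFibers_block h₁.1)
    (by rw [e]; exact decreasingOnFibers_block h₂.2)
    (by rw [e]; exact decreasingOnFibers_block h₂.1)
  rw [← this, e]

/-! ### Block sizes and the associated partition -/

/-- Describes each block as a half-open interval between consecutive cut points. The left sentinel
`s`, which is `0` in the application, is kept general so that the induction can replace it by the
head of the list. -/
theorem countP_le_eq_iff {p : List ℕ} (hp : p.Pairwise (· < ·)) {s x : ℕ} (hsx : s ≤ x)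
    (hs : ∀ q ∈ p, s < q) {t : ℕ} (ht : t < p.length) :
    p.countP (· ≤ x) = t ↔ (s :: p)[t]'(by simp; omega) ≤ x ∧ x < p[t] := by
  induction p generalizing s t with
  | nil => simp at ht
  | cons q p ih =>
    rw [List.pairwise_cons] at hp
    by_cases hq : q ≤ x
    · rw [List.countP_cons_of_pos (by simpa using hq)]
      cases t with
      | zero => simp; omega
      | succ t =>
        rw [Nat.add_right_cancel_iff, ih hp.2 hq hp.1 (by simpa using ht)]
        simp
    · have h0 : p.countP (· ≤ x) = 0 := by
        rw [List.countP_eq_zero]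
        intro r hr
        have := hp.1 r hr
        simp; omega
      rw [List.countP_cons_of_neg (by simpa using hq), h0]
      cases t with
      | zero => simp; omega
      | succ t =>
        simp only [List.getElem_cons_succ]
        have : q ≤ (q :: p)[t]'(by simp at ht ⊢; omega) := by
          cases t with
          | zero => simp
          | succ t => exact (hp.1 _ (List.getElem_mem _)).le
        constructor
        · intro h; omega
        · rintro ⟨h, -⟩; omega

theorem exists_equiv_of_perm {l l' : List ℕ} (h : l.Perm l') :
    ∃ e : Fin l.length ≃ Fin l'.length, ∀ t, l'[(e t).1] = l[t.1] := by
  have hcard : ∀ c, Nonempty ({t : Fin l.length // l[t.1] = c} ≃ {t : Fin l'.length // l'[t.1] = c}) := by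
    intro c
    have key : ∀ l : List ℕ, Fintype.card {t : Fin l.length // l[t.1] = c} = l.count c := by
      intro l
      rw [Fintype.card_subtype]
      exact Fin.card_filter_univ_eq_vector_get_eq_count c ⟨l, rfl⟩
    exact ⟨Fintype.equivOfCardEq (by rw [key, key, h.count_eq])⟩
  exact ⟨ofFiberEquiv fun c => (hcard c).some, fun t => ofFiberEquiv_map _ t⟩

theorem block_eq_countP (I : Finset ℕ) (x : Fin n) :
    block n I x = ((Icc 1 n \ I).sort (· ≤ ·)).countP (· ≤ x.1) := by
  rw [block, ← Multiset.coe_countP, sort_eq, Multiset.countP_eq_card_filter]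
  rfl

theorem length_composition (n : ℕ) (I : Finset ℕ) : (composition n I).length = #(Icc 1 n \ I) := by
  simp [composition]

theorem block_lt_length {I : Finset ℕ} (hI : I ⊆ Icc 1 (n - 1)) (x : Fin n) :
    block n I x < (composition n I).length := by
  have hx := x.2
  rw [length_composition, block]
  -- The cut point `n` is never in `I` and never counted, as positions are numbered from `0` to `n -
  -- 1`.
  refine card_lt_card (filter_ssubset.2 ⟨n, ?_, by omega⟩)
  rw [mem_sdiff, mem_Icc]
  refine ⟨by omega, fun h => ?_⟩
  have := mem_Icc.1 (hI h)
  omega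

theorem card_block_eq (I : Finset ℕ) {t : ℕ} (ht : t < (composition n I).length) :
    #{x : Fin n | block n I x = t} = (composition n I)[t] := by
  set p := (Icc 1 n \ I).sort (· ≤ ·) with hp
  have hmem : ∀ q ∈ p, 1 ≤ q ∧ q ≤ n := fun q hq => by
    rw [hp, mem_sort, mem_sdiff, mem_Icc] at hq; exact hq.1
  have ht' : t < p.length := by rw [length_composition] at ht; simpa [hp] using ht
  have hpw : p.Pairwise (· < ·) := (Icc 1 n \ I).sortedLT_sort.pairwise
  have e : (composition n I)[t] = p[t] - (0 :: p)[t]'(by simp; omega) := by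
    simp [composition, ← hp]
  rw [e, ← Nat.card_Ico]
  refine card_bij (fun x _ => x.1) ?_ (fun _ _ _ _ h => Fin.ext h) ?_
  · intro x hx
    rw [mem_filter, block_eq_countP, countP_le_eq_iff hpw (Nat.zero_le _)
      (fun q hq => (hmem q hq).1) ht'] at hx
    exact mem_Ico.2 hx.2
  · intro y hy
    rw [mem_Ico] at hy
    refine ⟨⟨y, hy.2.trans_le (hmem _ (List.getElem_mem _)).2⟩, ?_, rfl⟩
    rw [mem_filter, block_eq_countP, countP_le_eq_iff hpw (Nat.zero_le _)
      (fun q hq => (hmem q hq).1) ht']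
    exact ⟨mem_univ _, hy⟩

/-- Sets with the same associated partition have block structures that differ by a permutation of
the positions. -/
theorem exists_perm_block {I I' : Finset ℕ} (hI : I ⊆ Icc 1 (n - 1)) (hI' : I' ⊆ Icc 1 (n - 1))
    (h : partition n I = partition n I') :
    ∃ τ : Perm (Fin n), ∀ x y, block n I (τ x) = block n I (τ y) ↔ block n I' x = block n I' y := by
  have hperm : (composition n I').Perm (composition n I) :=
    (List.perm_insertionSort _ _).symm.trans
      ((List.Perm.of_eq h.symm).trans (List.perm_insertionSort _ _))
  obtain ⟨e, he⟩ := exists_equiv_of_perm hperm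
  let f : Fin n → Fin (composition n I).length := fun x => e ⟨block n I' x, block_lt_length hI' x⟩
  let g : Fin n → Fin (composition n I).length := fun x => ⟨block n I x, block_lt_length hI x⟩
  -- After relabelling by `e`, corresponding blocks have equal size, so bijections between them glue
  -- to a permutation of the positions.
  have hcard : ∀ c, Nonempty ({x // f x = c} ≃ {x // g x = c}) := by
    intro c
    obtain ⟨t, rfl⟩ := e.surjective c
    refine ⟨Fintype.equivOfCardEq ?_⟩
    rw [Fintype.card_subtype, Fintype.card_subtype]
    have h1 := card_block_eq I' t.2
    have h2 := card_block_eq I (e t).2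
    rw [he, ← h1] at h2
    simpa [f, g, Fin.ext_iff, e.injective.eq_iff] using h2.symm
  refine ⟨ofFiberEquiv fun c => (hcard c).some, fun x y => ?_⟩
  have hm := ofFiberEquiv_map (f := f) (g := g) fun c => (hcard c).some
  have hg : ∀ x y, block n I x = block n I y ↔ g x = g y := fun x y => by simp [g]
  have hf : ∀ x y, block n I' x = block n I' y ↔ f x = f y := fun x y => by
    simp [f, e.injective.eq_iff]
  rw [hg, hf, hm, hm]

theorem aHat_le {I I' J J' : Finset ℕ}
    (hI : I ⊆ Icc 1 (n - 1)) (hI' : I' ⊆ Icc 1 (n - 1))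
    (hJ : J ⊆ Icc 1 (n - 1)) (hJ' : J' ⊆ Icc 1 (n - 1))
    (h : partition n I = partition n I') (h' : partition n J = partition n J') :
    aHat n I' J' ≤ aHat n I J := by
  obtain ⟨τ, hτ⟩ := exists_perm_block hI hI' h
  obtain ⟨σ, hσ⟩ := exists_perm_block hJ hJ' h'
  rw [aHat_eq_card_descentPerms, aHat_eq_card_descentPerms]
  exact card_descentPerms_le hI hJ hτ hσ

theorem aHat_eq {I I' J J' : Finset ℕ}
    (hI : I ⊆ Icc 1 (n - 1)) (hI' : I' ⊆ Icc 1 (n - 1))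
    (hJ : J ⊆ Icc 1 (n - 1)) (hJ' : J' ⊆ Icc 1 (n - 1))
    (h : partition n I = partition n I') (h' : partition n J = partition n J') :
    aHat n I J = aHat n I' J' :=
  le_antisymm (aHat_le hI' hI hJ' hJ h.symm h'.symm) (aHat_le hI hI' hJ hJ' h h')

end BraidMonoid

theorem corollary3p5 (n : ℕ) (hn : 1 ≤ n) :
    (∀ I I' J J' : Finset ℕ,
      I ⊆ Finset.Icc 1 (n - 1) → I' ⊆ Finset.Icc 1 (n - 1) →
      J ⊆ Finset.Icc 1 (n - 1) → J' ⊆ Finset.Icc 1 (n - 1) →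
      BraidMonoid.partition n I = BraidMonoid.partition n I' →
      BraidMonoid.partition n J = BraidMonoid.partition n J' →
      BraidMonoid.aHat n I J = BraidMonoid.aHat n I' J') ∧
    (∀ I J J' : Finset ℕ,
      I ⊆ Finset.Icc 1 (n - 1) →
      J ⊆ Finset.Icc 1 (n - 1) → J' ⊆ Finset.Icc 1 (n - 1) →
      BraidMonoid.partition n J = BraidMonoid.partition n J' →
      BraidMonoid.a n I J = BraidMonoid.a n I J') :=
  ⟨fun _ _ _ _ hI hI' hJ hJ' h h' => BraidMonoid.aHat_eq hI hI' hJ hJ' h h',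
    fun I _ _ hI hJ hJ' h => BraidMonoid.a_eq_of_aHat_eq
      (fun _ hK => BraidMonoid.aHat_eq hK hK hJ hJ' rfl h) I hI⟩
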